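/- Let $V=\mathbb Z^{d_0}$. For every site $x\in V$ let $E_x$ be a measurable space (for instance $\mathbb N$, $\{0,\dots,N_x\}$ or $\mathbb R_+$), let $\Omega=\prod_{x\in V}E_x$, and let $\{\eta(t),\ t\ge 0\}$ be a time-homogeneous Markov process on $\Omega$. For every $x\in V$ let $\hat E_x\subset\mathbb N$ be a set containing $0$ and $1$, let $\hat\Omega$ be the set of finite configurations $\xi=(\xi_x)_{x\in V}$, that is, $\xi_x\in\hat E_x$ for all $x$ and $\xi_x=0$ for all but finitely many $x$, and put $|\xi|=\sum_x\xi_x$. Write $\delta_x\in\hat\Omega$ for the configuration with exactly one particle, located at $x$. Let $\{\xi(t),\ t\ge 0\}$ be a time-homogeneous Markov process on $\hat\Omega$ that conserves the number of particles: for all $t\ge 0$, $|\xi(t)|=|\xi(0)|$ almost surely. No translation invariance is assumed. Let $d_x(k,\cdot):E_x\to\mathbb R$ ($x\in V$, $k\in\hat E_x$) be measurable functions with $d_x(0,\cdot)\equiv 1$, and put $D(\xi,\eta)=\prod_{x\in V}d_x(\xi_x,\eta_x)$. Let $\mu$ be a probability measure on $\Omega$. Assume: 1. (Duality) for all $t>0$,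 $\xi\in\hat\Omega$, $\eta\in\Omega$ the expectations $\hat{\mathbb E}_\xi D(\xi(t),\eta)$ and $\mathbb E_\eta D(\xi,\eta(t))$ exist and are equal; 2. (Bounded harmonic triviality) every bounded $H:\hat\Omega\to\mathbb R$ with $\hat{\mathbb E}_\xi H(\xi(t))=H(\xi)$ for all $t>0$ and $\xi\in\hat\Omega$ is a function of $|\xi|$ only; 3. (Uniform domination) for every $n\in\mathbb N$ there is a $\mu$-integrable function $f_n$ with $|D(\xi,\eta)|\le f_n(\eta)$ for all $\eta\in\Omega$ and all $\xi\in\hat\Omega$ with $|\xi|=n$; 4. $\mu$ is stationary for $\{\eta(t),\ t\ge 0\}$ and ergodic in time: if $A\subset\Omega$ is measurable and for every $t\ge 0$ one has $\mathbb P_\eta(\eta(t)\in A)=\mathbf 1_A(\eta)$ for $\mu$-almost every $\eta$, then $\mu(A)\in\{0,1\}$; 5. the transition probabilities $p(t;x,y)=\hat{\mathbb P}_{\delta_x}(\xi(t)=\delta_y)$ of a single dual particle satisfy $\lim_{t\to\infty}p(t;x,y)=0$ for all $x,y\in V$. Then $$\int D(\xi,\eta)\,\mu(d\eta)=\Big(\int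 D(\delta_x,\eta)\,\mu(d\eta)\Big)^{|\xi|}\qquad\text{for all }\xi\in\hat\Omega,\ x\in V .$$ Consequently, if the single-site functions are measure determining, that is, if for every $x\in V$ any two probability measures $\nu,\nu'$ on $E_x$, with respect to both of which all $d_x(k,\cdot)$, $k\in\hat E_x$, are integrable and have equal integrals, coincide, then $\mu$ is a product measure. -/

import Mathlib

open MeasureTheory ProbabilityTheory Filter Topology
open scoped NNReal

/-- A time-homogeneous Markov process on `S`, given by its transition function: `P.kernel t η` is
the law at time `t` of the process started from `η`. -/
structure MarkovProcess (S : Type*) [MeasurableSpace S] where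
  kernel : ℝ≥0 → Kernel S S
  isMarkov : ∀ t, IsMarkovKernel (kernel t)
  kernel_zero : kernel 0 = Kernel.id
  chapman_kolmogorov : ∀ s t, kernel (s + t) = kernel t ∘ₖ kernel s

/-- `μ` is a stationary measure of the process `P`. -/
def MarkovProcess.IsStationary {S : Type*} [MeasurableSpace S] (P : MarkovProcess S) (μ : Measure S) : Prop :=
  ∀ t, Kernel.Invariant (P.kernel t) μ

/-- `μ` is ergodic in time for the process `P`: an event `A` that is invariant under the dynamics,
`S(t) 1_A = 1_A` `μ`-almost everywhere for every `t`, has measure zero or one. -/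
def MarkovProcess.IsTimeErgodic {S : Type*} [MeasurableSpace S] (P : MarkovProcess S) (μ : Measure S) : Prop :=
  ∀ A : Set S, MeasurableSet A →
    (∀ t, ∀ᵐ η ∂μ, P.kernel t η A = A.indicator 1 η) → μ A = 0 ∨ μ A = 1

/-- The duality relation between two processes with duality function `D`; that both expectations
exist is part of the relation. -/
structure IsDual {S T : Type*} [MeasurableSpace S] [MeasurableSpace T]
    (Phat : MarkovProcess S) (P : MarkovProcess T) (D : S → T → ℝ) : Prop where
  integrable_left : ∀ t > 0, ∀ ξ η, Integrable (fun ξ' => D ξ' η) (Phat.kernel t ξ)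
  integrable_right : ∀ t > 0, ∀ ξ η, Integrable (fun η' => D ξ η') (P.kernel t η)
  duality : ∀ t > 0, ∀ ξ η, ∫ ξ', D ξ' η ∂(Phat.kernel t ξ) = ∫ η', D ξ η' ∂(P.kernel t η)

/-- Configurations with finitely many particles, the number of particles at `x` being restricted
to the set `Ehat x`. -/
def FiniteConfig {V : Type*} (Ehat : V → Set ℕ) : Type _ :=
  {ξ : V →₀ ℕ // ∀ x, ξ x ∈ Ehat x}

namespace FiniteConfig

variable {V : Type*} {Ehat : V → Set ℕ}

instance : MeasurableSpace (FiniteConfig Ehat) := ⊤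

/-- The total number of particles `|ξ|`. -/
def size (ξ : FiniteConfig Ehat) : ℕ := ξ.1.sum fun _ k => k

/-- The configuration `δ_x` with a single particle, located at `x`. -/
noncomputable def delta (h0 : ∀ x, 0 ∈ Ehat x) (h1 : ∀ x, 1 ∈ Ehat x) (x : V) :
    FiniteConfig Ehat :=
  ⟨Finsupp.single x 1, fun y => by
    classical
    rw [Finsupp.single_apply]
    split_ifs
    · exact h1 y
    · exact h0 y⟩

end FiniteConfig

/-- The factorized duality function `D(ξ, η) = ∏ₓ d_x(ξ_x, η_x)`. Only the occupied sites of `ξ`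
enter the product; the other factors `d_x(0, η_x)` are equal to one for the single-site functions
considered here. -/
noncomputable def factorizedDuality {V : Type*} {E : V → Type*} (Ehat : V → Set ℕ)
    (d : (x : V) → ℕ → E x → ℝ) (ξ : FiniteConfig Ehat) (η : (x : V) → E x) : ℝ :=
  ξ.1.prod fun x k => d x k (η x)

/-- The dynamics conserves the number of particles almost surely. -/
def ConservesParticles {V : Type*} {Ehat : V → Set ℕ}
    (Phat : MarkovProcess (FiniteConfig Ehat)) : Prop :=
  ∀ t ξ, ∀ᵐ ξ' ∂(Phat.kernel t ξ), ξ'.size = ξ.size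

/-- Bounded harmonic triviality: bounded harmonic functions depend only on the number of
particles. -/
def BoundedHarmonicTriviality {V : Type*} {Ehat : V → Set ℕ}
    (Phat : MarkovProcess (FiniteConfig Ehat)) : Prop :=
  ∀ H : FiniteConfig Ehat → ℝ, (∃ C : ℝ, ∀ ξ, |H ξ| ≤ C) →
    (∀ t > 0, ∀ ξ, ∫ ξ', H ξ' ∂(Phat.kernel t ξ) = H ξ) →
    ∃ ψ : ℕ → ℝ, ∀ ξ, H ξ = ψ ξ.size

/-- Uniform domination: for each `n` the functions `D(ξ, ·)`, `|ξ| = n`, are dominated by one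
`μ`-integrable function. -/
def UniformDomination {V T : Type*} [MeasurableSpace T] {Ehat : V → Set ℕ}
    (D : FiniteConfig Ehat → T → ℝ) (μ : Measure T) : Prop :=
  ∀ n : ℕ, ∃ f : T → ℝ, Integrable f μ ∧
    ∀ η, ∀ ξ : FiniteConfig Ehat, ξ.size = n → |D ξ η| ≤ f η

/-- The single-site functions are measure determining: for every site `x`, a probability measure
on `E x` is determined, among those for which all `d_x(k, ·)` with `k ∈ Ehat x` are integrable,
by the integrals of these functions. -/
def MeasureDetermining {V : Type*} {E : V → Type*} [∀ x, MeasurableSpace (E x)]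
    (Ehat : V → Set ℕ) (d : (x : V) → ℕ → E x → ℝ) : Prop :=
  ∀ x, ∀ ν ν' : Measure (E x), IsProbabilityMeasure ν → IsProbabilityMeasure ν' →
    (∀ k ∈ Ehat x, Integrable (d x k) ν ∧ Integrable (d x k) ν' ∧
      ∫ e, d x k e ∂ν = ∫ e, d x k e ∂ν') →
    ν = ν'

/-- `μ` is the product of probability measures on the single-site spaces. -/
def IsProductMeasure {V : Type*} {E : V → Type*} [∀ x, MeasurableSpace (E x)]
    (μ : Measure ((x : V) → E x)) : Prop :=
  ∃ (ν : (x : V) → Measure (E x)) (_ : ∀ x, IsProbabilityMeasure (ν x)),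
    μ = Measure.infinitePi ν

/-! Duality and stationarity make `ξ ↦ ∫ D(ξ, ·) dμ` harmonic for the dual, and domination bounds it
on each sector `|ξ| = n`. Harmonic triviality then gives `∫ D(ξ, ·) dμ = ψ |ξ|`
(`exists_integral_eq_size`), and the moment formula reduces to `ψ (n + 1) = ψ n * ψ 1`.

For this recursion, add to an `n`-particle `ξ` one far-away random particle. Its law `π` is a convex
combination of late-time laws of the dual started from `δ_x`. Since `p(t; x, y) → 0`, the particle
avoids the support of `ξ` with probability near one, and off that support `D` factorizes. By duality
`∫ D(ξ', η) π(dξ')` is the same combination of evolved functions `S(t) D(δ_x, ·)`, which ergodicity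
brings close to `ψ 1` in `L¹(μ)` (`exists_spread_dual_law`). Dominated convergence gives the
recursion (`exists_size_succ_and_integral_mul`).

The mean ergodic theorem is obtained from the element of least norm in the closed convex hull of a
late orbit, not from time integrals, so no measurability or continuity in `t` is needed.

For the product property, the factors `d_x` are replaced by indicators one site at a time. What has
been built at the other sites, minus its mean, is orthogonal to every `d_x(k, ·)`, hence to every
event at `x` (`setIntegral_eq_zero_of_determining`). -/

/-- A family of contractions preserving a nonempty closed convex set has a common fixed point in it:
the element of least norm. -/
theorem exists_fixedPoint_of_contractions {H ι : Type*} [NormedAddCommGroup H]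
    [InnerProductSpace ℝ H] [CompleteSpace H] (S : ι → H → H) (hS : ∀ i h, ‖S i h‖ ≤ ‖h‖)
    {C : Set H} (hne : C.Nonempty) (hconv : Convex ℝ C) (hcl : IsClosed C)
    (hmaps : ∀ i, ∀ h ∈ C, S i h ∈ C) : ∃ g ∈ C, ∀ i, S i g = g := by
  obtain ⟨v, hvC, hv⟩ := exists_norm_eq_iInf_of_complete_convex hne hcl.isComplete hconv 0
  refine ⟨v, hvC, fun i => ?_⟩
  -- The variational inequality for the projection of `0` says `‖v‖² ≤ ⟪v, S i v⟫`; expanding `‖S i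
  -- v - v‖²` with `‖S i v‖ ≤ ‖v‖` then leaves nothing.
  have h1 := (norm_eq_iInf_iff_real_inner_le_zero hconv hvC).1 hv _ (hmaps i v hvC)
  have h2 := norm_sub_sq_real (S i v) v
  have h3 : ‖S i v‖ ^ 2 ≤ ‖v‖ ^ 2 := by gcongr; exact hS i v
  simp only [zero_sub, inner_neg_left, inner_sub_right, real_inner_self_eq_norm_sq] at h1
  rw [real_inner_comm] at h2
  have h4 : ‖S i v - v‖ ^ 2 = 0 := le_antisymm (by linarith) (sq_nonneg _)
  exact sub_eq_zero.1 (norm_eq_zero.1 (pow_eq_zero_iff two_ne_zero |>.1 h4))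

/-! ### The `L²` operator of a Markov kernel with invariant measure -/

section KernelL2

variable {S : Type*} [MeasurableSpace S] {κ : Kernel S S} [IsMarkovKernel κ] {μ : Measure S}
  [IsProbabilityMeasure μ]

theorem measurePreserving_fst_compProd (κ : Kernel S S) [IsMarkovKernel κ] (μ : Measure S)
    [IsProbabilityMeasure μ] : MeasurePreserving Prod.fst (μ ⊗ₘ κ) μ :=
  ⟨measurable_fst, Measure.fst_compProd μ κ⟩

theorem ProbabilityTheory.Kernel.Invariant.measurePreserving_snd (h : κ.Invariant μ) :
    MeasurePreserving Prod.snd (μ ⊗ₘ κ) μ :=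
  ⟨measurable_snd, (Measure.snd_compProd μ κ).trans h⟩

theorem ProbabilityTheory.Kernel.Invariant.ae_integrable (h : κ.Invariant μ) {f : S → ℝ}
    (hf : Integrable f μ) :
    ∀ᵐ η ∂μ, Integrable f (κ η) :=
  (Measure.integrable_compProd_iff (h.measurePreserving_snd.integrable_comp_of_integrable hf).1).1
    (h.measurePreserving_snd.integrable_comp_of_integrable hf) |>.1

theorem ProbabilityTheory.Kernel.Invariant.integrable_integral (h : κ.Invariant μ) {f : S → ℝ}
    (hf : Integrable f μ) :
    Integrable (fun η => ∫ η', f η' ∂κ η) μ :=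
  (h.measurePreserving_snd.integrable_comp_of_integrable hf :
    Integrable (fun z => f z.2) (μ ⊗ₘ κ)).integral_compProd

theorem ProbabilityTheory.Kernel.Invariant.integral_integral (h : κ.Invariant μ) {f : S → ℝ}
    (hf : Integrable f μ) :
    ∫ η, ∫ η', f η' ∂κ η ∂μ = ∫ η, f η ∂μ := by
  rw [← Measure.integral_compProd (f := fun z => f z.2)
    (h.measurePreserving_snd.integrable_comp_of_integrable hf)]
  have := integral_map (μ := μ ⊗ₘ κ) (f := f) measurable_snd.aemeasurable
    (by rw [h.measurePreserving_snd.map_eq]; exact hf.1)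
  rw [h.measurePreserving_snd.map_eq] at this
  exact this.symm

theorem ProbabilityTheory.Kernel.Invariant.integral_abs_integral_le (h : κ.Invariant μ)
    {f : S → ℝ} (hf : Integrable f μ) :
    ∫ η, |∫ η', f η' ∂κ η| ∂μ ≤ ∫ η, |f η| ∂μ := by
  rw [← h.integral_integral hf.abs]
  exact integral_mono (h.integrable_integral hf).abs (h.integrable_integral hf.abs)
    fun η => abs_integral_le_integral_abs

/-- The operator on `L²(μ)` induced by a Markov kernel with invariant measure `μ`, factored through
`L²` of the joint law of two consecutive states. -/
noncomputable def kernelL2 (h : κ.Invariant μ) : Lp ℝ 2 μ →L[ℝ] Lp ℝ 2 μ :=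
  (ContinuousLinearMap.adjoint (Lp.compMeasurePreservingₗᵢ ℝ (E := ℝ) (p := 2) Prod.fst
    (measurePreserving_fst_compProd κ μ)).toContinuousLinearMap).comp
  (Lp.compMeasurePreservingₗᵢ ℝ (E := ℝ) (p := 2) Prod.snd
    h.measurePreserving_snd).toContinuousLinearMap

theorem inner_kernelL2 (h : κ.Invariant μ) (f g : Lp ℝ 2 μ) :
    inner ℝ f (kernelL2 h g) =
      inner ℝ (Lp.compMeasurePreserving Prod.fst (measurePreserving_fst_compProd κ μ) f)
        (Lp.compMeasurePreserving Prod.snd h.measurePreserving_snd g) := by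
  rw [kernelL2, ContinuousLinearMap.comp_apply, ContinuousLinearMap.adjoint_inner_right]
  rfl

theorem norm_kernelL2_le (h : κ.Invariant μ) (f : Lp ℝ 2 μ) : ‖kernelL2 h f‖ ≤ ‖f‖ := by
  have h1 := real_inner_self_eq_norm_sq (kernelL2 h f)
  rw [inner_kernelL2] at h1
  have h2 := real_inner_le_norm
    (Lp.compMeasurePreserving Prod.fst (measurePreserving_fst_compProd κ μ) (kernelL2 h f))
    (Lp.compMeasurePreserving Prod.snd h.measurePreserving_snd f)
  rw [h1, Lp.norm_compMeasurePreserving, Lp.norm_compMeasurePreserving, sq] at h2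
  rcases (norm_nonneg (kernelL2 h f)).eq_or_lt with h0 | h0
  · rw [← h0]; exact norm_nonneg _
  · exact le_of_mul_le_mul_left h2 h0

/-- Both sides have the same integral over every measurable `s`: pairing with the indicator of `s`
turns the adjoint into an integral over `s × univ` under the joint law, which disintegrates along
`κ`. -/
theorem coeFn_kernelL2 (h : κ.Invariant μ) (f : Lp ℝ 2 μ) :
    kernelL2 h f =ᵐ[μ] fun η => ∫ η', f η' ∂κ η := by
  have hint : Integrable f μ := (Lp.memLp f).integrable one_le_two
  refine Integrable.ae_eq_of_forall_setIntegral_eq _ _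
    ((Lp.memLp (kernelL2 h f)).integrable one_le_two) (h.integrable_integral hint) fun s hs hμs => ?_
  rw [← L2.inner_indicatorConstLp_one (𝕜 := ℝ) hs hμs.ne, inner_kernelL2]
  have h1 : Lp.compMeasurePreserving Prod.fst (measurePreserving_fst_compProd κ μ)
      (indicatorConstLp 2 hs hμs.ne (1 : ℝ)) =
      indicatorConstLp (μ := μ ⊗ₘ κ) 2 (measurable_fst hs) (measure_ne_top _ _) 1 := by
    rfl
  rw [h1, L2.inner_indicatorConstLp_one]
  have h2 : ∀ᵐ z ∂((μ ⊗ₘ κ).restrict (Prod.fst ⁻¹' s)),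
      Lp.compMeasurePreserving Prod.snd h.measurePreserving_snd f z = f z.2 :=
    ae_restrict_of_ae (Lp.coeFn_compMeasurePreserving f h.measurePreserving_snd)
  rw [integral_congr_ae h2, ← Set.prod_univ, Measure.setIntegral_compProd (f := fun z => f z.2)
    hs MeasurableSet.univ (h.measurePreserving_snd.integrable_comp_of_integrable hint).integrableOn]
  simp

/-- The two states of the stationary chain see the same value of a fixed point of the kernel. -/
theorem ae_eq_of_kernelL2_eq (h : κ.Invariant μ) {g : Lp ℝ 2 μ} (hg : kernelL2 h g = g) :
    ∀ᵐ z ∂(μ ⊗ₘ κ), g z.1 = g z.2 := by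
  have h1 := inner_kernelL2 h g g
  rw [hg, real_inner_self_eq_norm_sq] at h1
  have h2 := norm_sub_sq_real
    (Lp.compMeasurePreserving Prod.fst (measurePreserving_fst_compProd κ μ) g)
    (Lp.compMeasurePreserving Prod.snd h.measurePreserving_snd g)
  rw [← h1, Lp.norm_compMeasurePreserving, Lp.norm_compMeasurePreserving] at h2
  -- The inner product and both squared norms equal `‖g‖²`, so the squared distance is `‖g‖² - 2‖g‖²
  -- + ‖g‖² = 0`.
  have h3 := sub_eq_zero.1 (norm_eq_zero.1 ((pow_eq_zero_iff two_ne_zero).1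
    (h2.trans (by ring))))
  have h4 := Lp.coeFn_compMeasurePreserving g (measurePreserving_fst_compProd κ μ)
  have h5 := Lp.coeFn_compMeasurePreserving g h.measurePreserving_snd
  rw [h3] at h4
  filter_upwards [h4, h5] with z hz4 hz5
  simpa using hz4.symm.trans hz5

theorem kernelL2_comp {κ' κ'' : Kernel S S} [IsMarkovKernel κ'] [IsMarkovKernel κ'']
    (h : κ.Invariant μ) (h' : κ'.Invariant μ) (h'' : κ''.Invariant μ) (hc : κ'' = κ' ∘ₖ κ)
    (f : Lp ℝ 2 μ) : kernelL2 h (kernelL2 h' f) = kernelL2 h'' f := by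
  have hint : Integrable f μ := (Lp.memLp f).integrable one_le_two
  -- The representative is known only `μ`-a.e.; invariance of `μ` transfers this to `κ η`-a.e. for
  -- almost every `η`.
  have h1 : ∀ᵐ η ∂μ, ∀ᵐ η' ∂κ η, kernelL2 h' f η' = ∫ ζ, f ζ ∂κ' η' := by
    refine Measure.ae_ae_of_ae_bind κ.measurable.aemeasurable ?_
    rw [show κ ∘ₘ μ = μ from h]
    exact coeFn_kernelL2 h' f
  refine Lp.ext ?_
  filter_upwards [coeFn_kernelL2 h (kernelL2 h' f), coeFn_kernelL2 h'' f, h1,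
    h''.ae_integrable hint] with η e1 e2 e3 e4
  subst hc
  rw [e1, e2, integral_congr_ae e3, Kernel.integral_comp e4]

end KernelL2

/-! ### Mean ergodic theorem for the semigroup -/

namespace MarkovProcess

variable {S : Type*} [MeasurableSpace S] {P : MarkovProcess S} {μ : Measure S}

instance (t : ℝ≥0) : IsMarkovKernel (P.kernel t) := P.isMarkov t

/-- Square integrable functions that are fixed by the semigroup are constant, by ergodicity. -/
theorem IsTimeErgodic.exists_ae_eq_const [IsProbabilityMeasure μ] (herg : P.IsTimeErgodic μ)
    (hstat : P.IsStationary μ) {g : Lp ℝ 2 μ} (hg : ∀ t, kernelL2 (hstat t) g = g) :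
    ∃ c : ℝ, g =ᵐ[μ] fun _ => c := by
  -- It suffices that every preimage `g ⁻¹' U` is null or conull. It is an invariant event, because
  -- from almost every `η` the process almost surely keeps the value `g η`.
  obtain ⟨c, hc⟩ := Filter.exists_eventuallyEq_const_of_forall_separating (l := ae μ) (f := g)
    MeasurableSet fun U hU => by
      have hgm : Measurable g := (Lp.stronglyMeasurable g).measurable
      have hA : MeasurableSet (g ⁻¹' U) := hgm hU
      have hinv : ∀ t, ∀ᵐ η ∂μ, P.kernel t η (g ⁻¹' U) = (g ⁻¹' U).indicator 1 η := fun t => by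
        filter_upwards [Measure.ae_ae_of_ae_compProd (ae_eq_of_kernelL2_eq (hstat t) (hg t))]
          with η hη
        by_cases hU : g η ∈ U
        · rw [Set.indicator_of_mem (by exact hU), Pi.one_apply, ← prob_compl_eq_zero_iff hA, measure_eq_zero_iff_ae_notMem]
          filter_upwards [hη] with ζ hζ
          simpa [← hζ] using hU
        · rw [Set.indicator_of_notMem (by exact hU), measure_eq_zero_iff_ae_notMem]
          filter_upwards [hη] with ζ hζ
          simpa [← hζ] using hU
      rcases herg _ hA hinv with h | h
      · exact Or.inr (measure_eq_zero_iff_ae_notMem.1 h)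
      · rw [← prob_compl_eq_zero_iff hA, measure_eq_zero_iff_ae_notMem] at h
        exact Or.inl (by simpa using h)
  exact ⟨c, hc⟩

/-- Mean ergodic theorem: the constant `∫ f` is in the closed convex hull of the evolved functions
at late times. -/
theorem IsTimeErgodic.exists_mem_closure_convexHull [IsProbabilityMeasure μ]
    (herg : P.IsTimeErgodic μ) (hstat : P.IsStationary μ) (f : Lp ℝ 2 μ) (T : ℝ≥0) :
    ∃ g ∈ closure (convexHull ℝ ((fun t => kernelL2 (hstat t) f) '' Set.Ici T)),
      g =ᵐ[μ] fun _ => ∫ η, f η ∂μ := by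
  set A := (fun t => kernelL2 (hstat t) f) '' Set.Ici T with hA
  have hmapsA : ∀ s, ∀ h ∈ A, kernelL2 (hstat s) h ∈ A := by
    rintro s _ ⟨t, ht, rfl⟩
    exact ⟨s + t, le_add_left (show T ≤ t from ht),
      (kernelL2_comp (hstat s) (hstat t) (hstat (s + t)) (P.chapman_kolmogorov s t) f).symm⟩
  have hmaps : ∀ s, ∀ h ∈ closure (convexHull ℝ A),
      kernelL2 (hstat s) h ∈ closure (convexHull ℝ A) := by
    intro s
    have h1 : Set.MapsTo (kernelL2 (hstat s)) (convexHull ℝ A) (convexHull ℝ A) := by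
      intro h hh
      have h3 : kernelL2 (hstat s) h ∈ (kernelL2 (hstat s)).toLinearMap '' convexHull ℝ A :=
        ⟨h, hh, rfl⟩
      rw [LinearMap.image_convexHull] at h3
      refine convexHull_mono ?_ h3
      rintro _ ⟨h, hh, rfl⟩
      exact hmapsA s h hh
    exact h1.closure (kernelL2 (hstat s)).continuous
  obtain ⟨g, hgC, hg⟩ := exists_fixedPoint_of_contractions (fun t => kernelL2 (hstat t))
    (fun t h => norm_kernelL2_le (hstat t) h)
    (((Set.nonempty_Ici (a := T)).image _).convexHull (𝕜 := ℝ)).closure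
    (convex_convexHull ℝ A).closure isClosed_closure hmaps
  obtain ⟨c, hc⟩ := herg.exists_ae_eq_const hstat hg
  -- The mean is a continuous linear functional equal to `∫ f` on the orbit, hence on its closed
  -- convex hull; this identifies the constant `c`.
  have key : ∀ h ∈ closure (convexHull ℝ A),
      inner ℝ (indicatorConstLp (μ := μ) 2 MeasurableSet.univ (measure_ne_top _ _) (1 : ℝ)) h
        = ∫ η, f η ∂μ := by
    set u := indicatorConstLp (μ := μ) 2 MeasurableSet.univ (measure_ne_top _ _) (1 : ℝ)
    have hcl : IsClosed {h : Lp ℝ 2 μ | inner ℝ u h = ∫ η, f η ∂μ} :=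
      isClosed_eq (by fun_prop) continuous_const
    have hcv : Convex ℝ {h : Lp ℝ 2 μ | inner ℝ u h = ∫ η, f η ∂μ} := by
      intro a ha b hb p q _ _ hpq
      simp only [Set.mem_ofPred_eq] at ha hb ⊢
      rw [inner_add_right, inner_smul_right, inner_smul_right, ha, hb, ← add_mul, hpq, one_mul]
    refine closure_minimal (convexHull_min ?_ hcv) hcl
    rintro _ ⟨t, -, rfl⟩
    change inner ℝ u _ = _
    rw [L2.inner_indicatorConstLp_one, setIntegral_univ,
      integral_congr_ae (coeFn_kernelL2 (hstat t) f)]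
    exact (hstat t).integral_integral ((Lp.memLp f).integrable one_le_two)
  refine ⟨g, hgC, ?_⟩
  have h1 := key g hgC
  rw [L2.inner_indicatorConstLp_one, setIntegral_univ, integral_congr_ae hc] at h1
  simp only [integral_const, probReal_univ, smul_eq_mul, one_mul] at h1
  rwa [← h1]

theorem integral_abs_le_norm [IsProbabilityMeasure μ] (u : Lp ℝ 2 μ) : ∫ η, |u η| ∂μ ≤ ‖u‖ := by
  have h1 : eLpNorm u 1 μ ≤ eLpNorm u 2 μ :=
    eLpNorm_le_eLpNorm_of_exponent_le one_le_two (Lp.aestronglyMeasurable u)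
  rw [eLpNorm_one_eq_lintegral_enorm,
    ← ofReal_integral_norm_eq_lintegral_enorm ((Lp.memLp u).integrable one_le_two)] at h1
  rw [Lp.norm_def]
  exact (ENNReal.ofReal_le_iff_le_toReal (Lp.eLpNorm_ne_top u)).1 h1

/-- Extends the `L²` statement to integrable `f`: a simple function `f'` approximates `f` in `L¹`,
and the averaged semigroup contracts `L¹`. The three errors of size `ε / 3` come from evolving `f -
f'`, from approximating in the hull, and from the difference of the means. -/
theorem IsTimeErgodic.exists_convexCombination [IsProbabilityMeasure μ]
    (herg : P.IsTimeErgodic μ) (hstat : P.IsStationary μ) {f : S → ℝ} (hf : Integrable f μ)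
    (T : ℝ≥0) {ε : ℝ} (hε : 0 < ε) :
    ∃ (ι : Type) (_ : Fintype ι) (w : ι → ℝ) (t : ι → ℝ≥0), (∀ i, 0 ≤ w i) ∧ ∑ i, w i = 1 ∧
      (∀ i, T ≤ t i) ∧
      ∫ η, |∑ i, w i * ∫ η', f η' ∂P.kernel (t i) η - ∫ η, f η ∂μ| ∂μ ≤ ε := by
  obtain ⟨f', hff', hf'⟩ := (memLp_one_iff_integrable.2 hf).exists_simpleFunc_eLpNorm_sub_lt
    ENNReal.one_ne_top (ε := ENNReal.ofReal (ε / 3)) (by simpa using hε)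
  have hf'i : Integrable f' μ := memLp_one_iff_integrable.1 hf'
  have hf'2 : MemLp f' 2 μ := f'.memLp_of_isFiniteMeasure 2 μ
  have hdist : ∫ η, |f η - f' η| ∂μ ≤ ε / 3 := by
    rw [eLpNorm_one_eq_lintegral_enorm, ← ofReal_integral_norm_eq_lintegral_enorm (hf.sub hf'i)]
      at hff'
    exact ((ENNReal.ofReal_lt_ofReal_iff (by positivity)).1 hff').le
  obtain ⟨g, hg, hgc⟩ := herg.exists_mem_closure_convexHull hstat hf'2.toLp T
  obtain ⟨h, hh, hgh⟩ := Metric.mem_closure_iff.1 hg (ε / 3) (by positivity)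
  obtain ⟨ι, _, w, z, hw0, hw1, hz, rfl⟩ := mem_convexHull_iff_exists_fintype.1 hh
  choose t htT hzt using hz
  refine ⟨ι, inferInstance, w, t, hw0, hw1, htT, ?_⟩
  have hI : ∀ i, Integrable (fun η => ∫ η', (f η' - f' η') ∂P.kernel (t i) η) μ := fun i =>
    (hstat (t i)).integrable_integral (hf.sub hf'i)
  have hz' : ∀ i, z i =ᵐ[μ] fun η => ∫ η', f' η' ∂P.kernel (t i) η := fun i => by
    have h2 : ∀ᵐ η ∂μ, ∀ᵐ η' ∂P.kernel (t i) η, hf'2.toLp f' η' = f' η' := by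
      refine Measure.ae_ae_of_ae_bind (P.kernel (t i)).measurable.aemeasurable ?_
      rw [show P.kernel (t i) ∘ₘ μ = μ from hstat (t i)]
      exact hf'2.coeFn_toLp
    rw [← hzt i]
    filter_upwards [coeFn_kernelL2 (hstat (t i)) hf'2.toLp, h2] with η e1 e2
    rw [e1, integral_congr_ae e2]
  have hsum : ∀ᵐ η ∂μ, (∑ i, w i • z i : Lp ℝ 2 μ) η = ∑ i, w i * z i η := by
    have e1 := Lp.coeFn_finsetSum Finset.univ (fun i => w i • z i)
    have e2 : ∀ᵐ η ∂μ, ∀ i, (w i • z i : Lp ℝ 2 μ) η = w i * z i η :=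
      ae_all_iff.2 fun i => Lp.coeFn_smul (w i) (z i)
    filter_upwards [e1, e2] with η h1 h2
    rw [h1, Finset.sum_apply]
    exact Finset.sum_congr rfl fun i _ => h2 i
  have hf'int : ∫ η, hf'2.toLp f' η ∂μ = ∫ η, f' η ∂μ := integral_congr_ae hf'2.coeFn_toLp
  have hpt : ∀ᵐ η ∂μ, |∑ i, w i * ∫ η', f η' ∂P.kernel (t i) η - ∫ η, f η ∂μ| ≤
      ∑ i, w i * |∫ η', (f η' - f' η') ∂P.kernel (t i) η| +
        |(g - ∑ i, w i • z i : Lp ℝ 2 μ) η| + |∫ η, (f η - f' η) ∂μ| := by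
    filter_upwards [hgc, hsum, ae_all_iff.2 hz', Lp.coeFn_sub g (∑ i, w i • z i),
      ae_all_iff.2 fun i => (hstat (t i)).ae_integrable hf,
      ae_all_iff.2 fun i => (hstat (t i)).ae_integrable hf'i] with η e1 e2 e3 e4 e5 e6
    rw [e4, Pi.sub_apply, e1, e2, hf'int, integral_sub hf hf'i]
    have e7 : ∑ i, w i * ∫ η', f η' ∂P.kernel (t i) η - ∫ η, f η ∂μ =
        ∑ i, w i * ∫ η', (f η' - f' η') ∂P.kernel (t i) η -
        (∫ η, f' η ∂μ - ∑ i, w i * z i η) - (∫ η, f η ∂μ - ∫ η, f' η ∂μ) := by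
      simp only [e3, integral_sub (e5 _) (e6 _), mul_sub, Finset.sum_sub_distrib]
      ring
    rw [e7]
    refine (abs_sub _ _).trans (add_le_add_left ((abs_sub _ _).trans (add_le_add_left ?_ _)) _)
    refine (Finset.abs_sum_le_sum_abs _ _).trans (Finset.sum_le_sum fun i _ => ?_)
    rw [abs_mul, abs_of_nonneg (hw0 i)]
  have hi1 : Integrable (fun η => ∑ i, w i * |∫ η', (f η' - f' η') ∂P.kernel (t i) η|) μ :=
    integrable_finsetSum _ fun i _ => (hI i).abs.const_mul _
  have hi2 : Integrable (fun η => |(g - ∑ i, w i • z i : Lp ℝ 2 μ) η|) μ :=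
    ((Lp.memLp _).integrable one_le_two).abs
  have hi12 : Integrable (fun η => ∑ i, w i * |∫ η', (f η' - f' η') ∂P.kernel (t i) η| +
      |(g - ∑ i, w i • z i : Lp ℝ 2 μ) η|) μ := hi1.add hi2
  refine (integral_mono_of_nonneg (ae_of_all _ fun η => abs_nonneg _)
    (hi12.add (integrable_const _)) hpt).trans ?_
  rw [integral_add' hi12 (integrable_const _), integral_add hi1 hi2,
    integral_finsetSum _ fun i _ => (hI i).abs.const_mul _]
  simp only [integral_const_mul, integral_const, probReal_univ, smul_eq_mul, one_mul]
  have b1 : ∑ i, w i * ∫ η, |∫ η', (f η' - f' η') ∂P.kernel (t i) η| ∂μ ≤ ε / 3 := by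
    calc _ ≤ ∑ i, w i * (ε / 3) := Finset.sum_le_sum fun i _ => mul_le_mul_of_nonneg_left
            (((hstat (t i)).integral_abs_integral_le (hf.sub hf'i)).trans hdist) (hw0 i)
      _ = ε / 3 := by rw [← Finset.sum_mul, hw1, one_mul]
  have b2 := (integral_abs_le_norm (g - ∑ i, w i • z i)).trans (dist_eq_norm g _ ▸ hgh).le
  have b3 := (abs_integral_le_integral_abs (μ := μ) (f := fun η => f η - f' η)).trans hdist
  linarith

end MarkovProcess

/-! ### Superposition of finite configurations -/

namespace FiniteConfig

variable {V : Type*} {Ehat : V → Set ℕ}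

instance [Countable V] : Countable (FiniteConfig Ehat) :=
  inferInstanceAs (Countable {ξ : V →₀ ℕ // ∀ x, ξ x ∈ Ehat x})

instance : DiscreteMeasurableSpace (FiniteConfig Ehat) := ⟨fun _ => trivial⟩

/-- The superposition of two configurations with disjoint supports (and `ξ` when the supports
meet). -/
noncomputable def merge (ξ ξ' : FiniteConfig Ehat) : FiniteConfig Ehat :=
  open Classical in
  if h : Disjoint ξ.1.support ξ'.1.support then
    ⟨ξ.1 + ξ'.1, fun x => by
      by_cases hx : x ∈ ξ.1.support
      · have := Finsupp.notMem_support_iff.1 (Finset.disjoint_left.1 h hx)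
        simpa [this] using ξ.2 x
      · simpa [Finsupp.notMem_support_iff.1 hx] using ξ'.2 x⟩
  else ξ

variable {ξ ξ' : FiniteConfig Ehat}

theorem merge_val (h : Disjoint ξ.1.support ξ'.1.support) : (merge ξ ξ').1 = ξ.1 + ξ'.1 :=
  congrArg Subtype.val (dif_pos h)

theorem size_merge (h : Disjoint ξ.1.support ξ'.1.support) :
    (merge ξ ξ').size = ξ.size + ξ'.size := by
  rw [size, merge_val h, Finsupp.sum_add_index' (fun _ => rfl) (fun _ _ _ => rfl)]
  rfl

theorem factorizedDuality_merge {E : V → Type*} {d : (x : V) → ℕ → E x → ℝ}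
    (h : Disjoint ξ.1.support ξ'.1.support) (η : (x : V) → E x) :
    factorizedDuality Ehat d (merge ξ ξ') η =
      factorizedDuality Ehat d ξ η * factorizedDuality Ehat d ξ' η := by
  rw [factorizedDuality, merge_val h, Finsupp.prod_add_index_of_disjoint h]
  rfl

theorem size_delta (h0 : ∀ x, 0 ∈ Ehat x) (h1 : ∀ x, 1 ∈ Ehat x) (x : V) :
    (delta h0 h1 x).size = 1 :=
  Finsupp.sum_single_index rfl

/-- The configuration without particles. -/
def empty (h0 : ∀ x, 0 ∈ Ehat x) : FiniteConfig Ehat := ⟨0, h0⟩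

theorem size_empty (h0 : ∀ x, 0 ∈ Ehat x) : (empty h0).size = 0 :=
  Finsupp.sum_zero_index

theorem eq_delta_of_size_eq_one (h0 : ∀ x, 0 ∈ Ehat x) (h1 : ∀ x, 1 ∈ Ehat x)
    (h : ξ.size = 1) {x : V} (hx : x ∈ ξ.1.support) : ξ = delta h0 h1 x := by
  obtain ⟨y, hy⟩ := (Finsupp.sum_eq_one_iff ξ.1).1 h
  rw [hy, Finsupp.support_single y one_ne_zero, Finset.mem_singleton] at hx
  subst hx
  exact Subtype.ext hy

end FiniteConfig

theorem factorizedDuality_empty {V : Type*} {E : V → Type*} {Ehat : V → Set ℕ}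
    {d : (x : V) → ℕ → E x → ℝ} (h0 : ∀ x, 0 ∈ Ehat x) (η : (x : V) → E x) :
    factorizedDuality Ehat d (FiniteConfig.empty h0) η = 1 :=
  Finsupp.prod_zero_index

theorem measurable_factorizedDuality {V : Type*} {E : V → Type*} [∀ x, MeasurableSpace (E x)]
    {Ehat : V → Set ℕ} {d : (x : V) → ℕ → E x → ℝ}
    (hd : ∀ x, ∀ k ∈ Ehat x, Measurable (d x k)) (ξ : FiniteConfig Ehat) :
    Measurable (factorizedDuality Ehat d ξ) :=
  Finset.measurable_prod _ fun x _ => (hd x _ (ξ.2 x)).comp (measurable_pi_apply x)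

/-! ### Harmonicity of the moments -/

section Harmonic

variable {V : Type*} {Ehat : V → Set ℕ} {T : Type*} [MeasurableSpace T]
  {P : MarkovProcess T} {Phat : MarkovProcess (FiniteConfig Ehat)} {D : FiniteConfig Ehat → T → ℝ}
  {μ : Measure T}

theorem UniformDomination.integrable (hUD : UniformDomination D μ) (hD : ∀ ξ, Measurable (D ξ))
    (ξ : FiniteConfig Ehat) : Integrable (D ξ) μ := by
  obtain ⟨f, hf, hfD⟩ := hUD ξ.size
  exact hf.mono' (hD ξ).aestronglyMeasurable (ae_of_all _ fun η => hfD η ξ rfl)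

theorem UniformDomination.integrable_prod [Countable V] [SFinite μ] (hUD : UniformDomination D μ)
    (hD : ∀ ξ, Measurable (D ξ)) {π : Measure (FiniteConfig Ehat)} [IsFiniteMeasure π] {n : ℕ}
    (hπ : ∀ᵐ ξ ∂π, ξ.size = n) : Integrable (fun z : FiniteConfig Ehat × T => D z.1 z.2)
      (π.prod μ) := by
  obtain ⟨f, hf, hfD⟩ := hUD n
  refine (hf.comp_snd π).mono' (measurable_from_prod_countable_right hD).aestronglyMeasurable ?_
  filter_upwards [Measure.quasiMeasurePreserving_fst.ae hπ] with z hz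
  exact hfD z.2 z.1 hz

theorem exists_integral_eq_size [Countable V] [IsProbabilityMeasure μ] (hcons : ConservesParticles Phat)
    (hdual : IsDual Phat P D) (hBHT : BoundedHarmonicTriviality Phat)
    (hD : ∀ ξ, Measurable (D ξ)) (hUD : UniformDomination D μ) (hstat : P.IsStationary μ) :
    ∃ ψ : ℕ → ℝ, ∀ ξ, ∫ η, D ξ η ∂μ = ψ ξ.size := by
  classical
  have key : ∀ n : ℕ, ∃ c : ℝ, ∀ ξ : FiniteConfig Ehat, ξ.size = n → ∫ η, D ξ η ∂μ = c := by
    intro n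
    obtain ⟨f, hf, hfD⟩ := hUD n
    -- The bound depends on the sector, so the moment function is cut off to `|ξ| = n`; conservation
    -- of particles keeps the cut-off function harmonic.
    set H : FiniteConfig Ehat → ℝ := fun ξ => if ξ.size = n then ∫ η, D ξ η ∂μ else 0 with hH
    have hbdd : ∀ ξ, |H ξ| ≤ |∫ η, f η ∂μ| := fun ξ => by
      simp only [hH]
      split_ifs with h
      · refine (abs_integral_le_integral_abs.trans (integral_mono
          (hUD.integrable hD ξ).abs hf fun η => hfD η ξ h)).trans (le_abs_self _)
      · simp
    have hharm : ∀ t > 0, ∀ ξ, ∫ ξ', H ξ' ∂(Phat.kernel t ξ) = H ξ := fun t ht ξ => by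
      simp only [hH]
      split_ifs with hξ
      · have h1 : ∀ᵐ ξ' ∂Phat.kernel t ξ, ξ'.size = n := by
          filter_upwards [hcons t ξ] with ξ' h using h.trans hξ
        have h2 : ∀ᵐ ξ' ∂Phat.kernel t ξ, (if ξ'.size = n then ∫ η, D ξ' η ∂μ else 0) =
            ∫ η, D ξ' η ∂μ := by
          filter_upwards [h1] with ξ' h using if_pos h
        rw [integral_congr_ae h2, integral_integral_swap (hUD.integrable_prod hD h1)]
        simp_rw [hdual.duality t ht]
        exact (hstat t).integral_integral (hUD.integrable hD ξ)
      · refine integral_eq_zero_of_ae ?_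
        filter_upwards [hcons t ξ] with ξ' h
        exact if_neg (h ▸ hξ)
    obtain ⟨ψ, hψ⟩ := hBHT H ⟨_, hbdd⟩ hharm
    refine ⟨ψ n, fun ξ hξ => ?_⟩
    have := hψ ξ
    simp only [hH] at this
    rwa [if_pos hξ, hξ] at this
  choose ψ hψ using key
  exact ⟨ψ, fun ξ => hψ _ ξ rfl⟩

end Harmonic

/-! ### Spreading out a single dual particle -/

section Mixture

theorem exists_mixture {α ι : Type*} [MeasurableSpace α] [Fintype ι] (m : ι → Measure α)
    [∀ i, IsProbabilityMeasure (m i)] {w : ι → ℝ} (hw0 : ∀ i, 0 ≤ w i) (hw1 : ∑ i, w i = 1) :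
    ∃ π : Measure α, IsProbabilityMeasure π ∧
      (∀ p : α → Prop, (∀ i, ∀ᵐ a ∂m i, p a) → ∀ᵐ a ∂π, p a) ∧
      (∀ s, π.real s = ∑ i, w i * (m i).real s) ∧
      ∀ f : α → ℝ, (∀ i, Integrable f (m i)) → ∫ a, f a ∂π = ∑ i, w i * ∫ a, f a ∂m i := by
  have happ : ∀ s, (∑ i, ENNReal.ofReal (w i) • m i) s = ∑ i, ENNReal.ofReal (w i) * m i s :=
    fun s => by simp
  refine ⟨∑ i, ENNReal.ofReal (w i) • m i, ⟨?_⟩, fun p hp => ?_, fun s => ?_, fun f hf => ?_⟩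
  · rw [happ]
    simp only [measure_univ, mul_one]
    rw [← ENNReal.ofReal_sum_of_nonneg fun i _ => hw0 i, hw1, ENNReal.ofReal_one]
  · rw [ae_iff, happ]
    exact Finset.sum_eq_zero fun i _ => by rw [ae_iff.1 (hp i), mul_zero]
  · rw [measureReal_def, happ, ENNReal.toReal_sum fun i _ =>
      ENNReal.mul_ne_top ENNReal.ofReal_ne_top (measure_ne_top _ _)]
    exact Finset.sum_congr rfl fun i _ => by
      rw [ENNReal.toReal_mul, ENNReal.toReal_ofReal (hw0 i), measureReal_def]
  · rw [integral_finsetSum_measure fun i _ => (hf i).smul_measure ENNReal.ofReal_ne_top]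
    exact Finset.sum_congr rfl fun i _ => by
      rw [integral_smul_measure, ENNReal.toReal_ofReal (hw0 i), smul_eq_mul]

variable {V : Type*} {Ehat : V → Set ℕ} {T : Type*} [MeasurableSpace T]
  {P : MarkovProcess T} {Phat : MarkovProcess (FiniteConfig Ehat)} {D : FiniteConfig Ehat → T → ℝ}
  {μ : Measure T} [IsProbabilityMeasure μ]

/-- By ergodicity, the law of a single dual particle can be averaged over late times in such a way
that `D` is close to its mean, while the particle avoids a given finite set. -/
theorem exists_spread_dual_law (h0 : ∀ x, 0 ∈ Ehat x) (h1 : ∀ x, 1 ∈ Ehat x)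
    (hcons : ConservesParticles Phat) (hdual : IsDual Phat P D) (hD : ∀ ξ, Measurable (D ξ))
    (hUD : UniformDomination D μ) (hstat : P.IsStationary μ) (herg : P.IsTimeErgodic μ) (x : V)
    (hp : ∀ y, Tendsto (fun t : ℝ≥0 => (Phat.kernel t (FiniteConfig.delta h0 h1 x)).real
      {FiniteConfig.delta h0 h1 y}) atTop (𝓝 0)) (s : Finset V) {ε : ℝ} (hε : 0 < ε) :
    ∃ π : Measure (FiniteConfig Ehat), IsProbabilityMeasure π ∧ (∀ᵐ ξ ∂π, ξ.size = 1) ∧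
      π.real {ξ | ¬ Disjoint s ξ.1.support} ≤ ε ∧
      ∫ η, |∫ ξ, D ξ η ∂π - ∫ η, D (FiniteConfig.delta h0 h1 x) η ∂μ| ∂μ ≤ ε := by
  set δ := FiniteConfig.delta h0 h1
  have hlim : Tendsto (fun t : ℝ≥0 => ∑ y ∈ s, (Phat.kernel t (δ x)).real {δ y}) atTop (𝓝 0) := by
    simpa using tendsto_finsetSum s fun y _ => hp y
  obtain ⟨T₀, hT₀⟩ := eventually_atTop.1 (hlim.eventually (gt_mem_nhds hε))
  -- Times beyond `T₀` make every visit probability to `s` small; times at least `1` are positive,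
  -- as the duality relation requires.
  obtain ⟨ι, _, w, t, hw0, hw1, ht, hclose⟩ := herg.exists_convexCombination hstat
    (hUD.integrable hD (δ x)) (max T₀ 1) hε
  obtain ⟨π, hπ, hae, hreal, hint⟩ := exists_mixture (fun i => Phat.kernel (t i) (δ x)) hw0 hw1
  have htpos : ∀ i, 0 < t i := fun i => zero_lt_one.trans_le ((le_max_right _ _).trans (ht i))
  have hsize : ∀ i, ∀ᵐ ξ ∂Phat.kernel (t i) (δ x), ξ.size = 1 := fun i => by
    filter_upwards [hcons (t i) (δ x)] with ξ h
    exact h.trans (FiniteConfig.size_delta h0 h1 x)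
  refine ⟨π, hπ, hae _ hsize, ?_, ?_⟩
  · rw [hreal]
    calc _ ≤ ∑ i, w i * ε := Finset.sum_le_sum fun i _ =>
          mul_le_mul_of_nonneg_left (le_trans ?_ (hT₀ (t i) ((le_max_left _ _).trans (ht i))).le)
            (hw0 i)
      _ = ε := by rw [← Finset.sum_mul, hw1, one_mul]
    refine le_trans ?_ (measureReal_biUnion_finset_le s _)
    refine ENNReal.toReal_mono (measure_ne_top _ _) (measure_mono_ae ?_)
    filter_upwards [hsize i] with ξ hξ h
    obtain ⟨y, hys, hy⟩ := Finset.not_disjoint_iff.1 h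
    exact Set.mem_biUnion hys (FiniteConfig.eq_delta_of_size_eq_one h0 h1 hξ hy)
  · refine le_of_eq_of_le ?_ hclose
    refine integral_congr_ae (ae_of_all _ fun η => ?_)
    simp only
    rw [hint _ fun i => hdual.integrable_left (t i) (htpos i) (δ x) η]
    simp_rw [hdual.duality _ (htpos _)]

end Mixture

/-! ### The recursion for the moments -/

section Factorization

variable {V : Type*} [Countable V] {E : V → Type*} [∀ x, MeasurableSpace (E x)] {Ehat : V → Set ℕ}
  {P : MarkovProcess ((x : V) → E x)} {Phat : MarkovProcess (FiniteConfig Ehat)}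
  {d : (x : V) → ℕ → E x → ℝ} {μ : Measure ((x : V) → E x)} [IsProbabilityMeasure μ]

theorem exists_size_succ_and_integral_mul (h0 : ∀ x, 0 ∈ Ehat x) (h1 : ∀ x, 1 ∈ Ehat x)
    (hcons : ConservesParticles Phat) (hdual : IsDual Phat P (factorizedDuality Ehat d))
    (hd : ∀ x, ∀ k ∈ Ehat x, Measurable (d x k))
    (hUD : UniformDomination (factorizedDuality Ehat d) μ) (hstat : P.IsStationary μ)
    (herg : P.IsTimeErgodic μ) (x : V)
    (hp : ∀ y, Tendsto (fun t : ℝ≥0 => (Phat.kernel t (FiniteConfig.delta h0 h1 x)).real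
      {FiniteConfig.delta h0 h1 y}) atTop (𝓝 0)) {ψ : ℕ → ℝ}
    (hψ : ∀ ξ, ∫ η, factorizedDuality Ehat d ξ η ∂μ = ψ ξ.size) (ξ : FiniteConfig Ehat) :
    (∃ ξ' : FiniteConfig Ehat, ξ'.size = ξ.size + 1) ∧ ψ (ξ.size + 1) = ψ ξ.size * ψ 1 := by
  have hD := measurable_factorizedDuality hd
  set D := factorizedDuality Ehat d
  set N : Set (FiniteConfig Ehat) := {ξ' | Disjoint ξ.1.support ξ'.1.support} with hN
  have hεpos : ∀ k : ℕ, (0 : ℝ) < 1 / ((k : ℝ) + 1) := fun k => Nat.one_div_pos_of_nat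
  have hε : Tendsto (fun k : ℕ => 1 / ((k : ℝ) + 1)) atTop (𝓝 0) :=
    tendsto_one_div_add_atTop_nhds_zero_nat
  have hspread := fun k : ℕ => exists_spread_dual_law h0 h1 hcons hdual hD hUD hstat herg x hp
    ξ.1.support (hεpos k)
  choose π hπ hsize hesc hclose using hspread
  rw [hψ, FiniteConfig.size_delta] at hclose
  have hNm : MeasurableSet N := trivial
  have hNlim : Tendsto (fun k => (π k).real N) atTop (𝓝 1) := by
    have h2 : Tendsto (fun k => (π k).real Nᶜ) atTop (𝓝 0) :=
      squeeze_zero (fun k => measureReal_nonneg) hesc hε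
    have h3 := h2.const_sub 1
    simp_rw [probReal_compl_eq_one_sub hNm, sub_sub_cancel, sub_zero] at h3
    exact h3
  -- The unnormalized law of `ξ` with the random particle added, on the event that they do not
  -- overlap. It lives on size `|ξ| + 1`, so the dominating function of that sector applies; the
  -- product of the bounds for `|ξ|` and `1` need not be integrable.
  set ρ : ℕ → Measure (FiniteConfig Ehat) := fun k =>
    ((π k).restrict N).map (FiniteConfig.merge ξ) with hρ
  have hρsize : ∀ k, ∀ᵐ ξ' ∂ρ k, ξ'.size = ξ.size + 1 := fun k => by
    rw [hρ, ae_map_iff (Measurable.of_discrete).aemeasurable (MeasurableSet.of_discrete), ae_restrict_iff' hNm]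
    filter_upwards [hsize k] with ξ' hξ' hξN
    rw [FiniteConfig.size_merge hξN, hξ']
  have hρmass : ∀ k, (ρ k).real Set.univ = (π k).real N := fun k => by
    rw [hρ, map_measureReal_apply Measurable.of_discrete MeasurableSet.univ]
    simp
  have hρint : ∀ k η, ∫ ξ', D ξ' η ∂ρ k = D ξ η * ∫ ξ' in N, D ξ' η ∂π k := fun k η => by
    rw [hρ, integral_map (Measurable.of_discrete).aemeasurable
      Measurable.of_discrete.aestronglyMeasurable, ← integral_const_mul]
    exact setIntegral_congr_fun hNm fun ξ' hξ' => FiniteConfig.factorizedDuality_merge hξ' η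
  obtain ⟨f, hf, hfD⟩ := hUD (ξ.size + 1)
  obtain ⟨f₁, hf₁, hfD₁⟩ := hUD 1
  have hBint : ∀ k, ∫ η, D ξ η * ∫ ξ' in N, D ξ' η ∂π k ∂μ = (π k).real N * ψ (ξ.size + 1) :=
    fun k => by
      simp_rw [← hρint]
      rw [← integral_integral_swap (hUD.integrable_prod hD (hρsize k)),
        integral_congr_ae (g := fun _ => ψ (ξ.size + 1)) ?_, integral_const, hρmass, smul_eq_mul]
      filter_upwards [hρsize k] with ξ' h
      rw [hψ, h]
  have hBbound : ∀ k η, |D ξ η * ∫ ξ' in N, D ξ' η ∂π k| ≤ |f η| := fun k η => by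
    rw [← hρint, ← Real.norm_eq_abs]
    refine (norm_integral_le_of_norm_le_const (C := |f η|) ?_).trans ?_
    · filter_upwards [hρsize k] with ξ' h using (hfD η ξ' h).trans (le_abs_self _)
    · rw [hρmass]
      exact mul_le_of_le_one_right (abs_nonneg _) measureReal_le_one
  have hAB : ∀ k η, |∫ ξ' in N, D ξ' η ∂π k - ∫ ξ', D ξ' η ∂π k| ≤ |f₁ η| * (1 / ((k : ℝ) + 1)) :=
    fun k η => by
      have hb : ∀ᵐ ξ' ∂π k, ‖D ξ' η‖ ≤ |f₁ η| := by
        filter_upwards [hsize k] with ξ' h using (hfD₁ η ξ' h).trans (le_abs_self _)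
      have hi : Integrable (fun ξ' => D ξ' η) (π k) :=
        (integrable_const |f₁ η|).mono' Measurable.of_discrete.aestronglyMeasurable hb
      rw [← integral_add_compl hNm hi, sub_add_cancel_left, abs_neg]
      exact (norm_setIntegral_le_of_norm_le_const_ae' (measure_lt_top _ _)
        (hb.mono fun _ h _ => h)).trans (mul_le_mul_of_nonneg_left (hesc k) (abs_nonneg _))
  have hAi : ∀ k, Integrable (fun η => ∫ ξ', D ξ' η ∂π k) μ := fun k =>
    (hUD.integrable_prod hD (hsize k)).integral_prod_right
  have hAlim : TendstoInMeasure μ (fun k η => ∫ ξ', D ξ' η ∂π k) atTop fun _ => ψ 1 := by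
    refine tendstoInMeasure_of_tendsto_eLpNorm one_ne_zero (fun k => (hAi k).1)
      aestronglyMeasurable_const ?_
    have h2 : Tendsto (fun k : ℕ => ENNReal.ofReal (1 / ((k : ℝ) + 1))) atTop (𝓝 0) := by
      simpa using ENNReal.tendsto_ofReal hε
    refine tendsto_of_tendsto_of_tendsto_of_le_of_le tendsto_const_nhds h2 (fun _ => zero_le)
      fun k => ?_
    rw [eLpNorm_one_eq_lintegral_enorm,
      ← ofReal_integral_norm_eq_lintegral_enorm ((hAi k).sub (integrable_const _))]
    exact ENNReal.ofReal_le_ofReal (hclose k)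
  -- `L¹` convergence is weakened to almost everywhere convergence along a subsequence, which is
  -- what dominated convergence uses.
  obtain ⟨ns, hns, hae⟩ := hAlim.exists_seq_tendsto_ae
  have hlim := tendsto_integral_of_dominated_convergence
    (F := fun k η => D ξ η * ∫ ξ' in N, D ξ' η ∂π (ns k)) (f := fun η => D ξ η * ψ 1)
    (fun η => |f η|) (fun k => by
      simp_rw [← hρint]
      exact (hUD.integrable_prod hD (hρsize _)).integral_prod_right.1)
    hf.abs (fun k => ae_of_all _ fun η => hBbound _ η) (by
      filter_upwards [hae] with η hη
      refine Tendsto.const_mul _ ?_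
      have h2 : Tendsto (fun k => |f₁ η| * (1 / ((ns k : ℝ) + 1))) atTop (𝓝 0) := by
        simpa using (hε.comp hns.tendsto_atTop).const_mul |f₁ η|
      simpa using (squeeze_zero_norm (fun k => hAB (ns k) η) h2).add hη)
  simp_rw [hBint, integral_mul_const, hψ] at hlim
  refine ⟨?_, ?_⟩
  · obtain ⟨k, hk⟩ := (hNlim.eventually (lt_mem_nhds one_pos)).exists
    have : (ae (ρ k)).NeBot := by
      rw [ae_neBot]
      intro h
      rw [← hρmass, h] at hk
      simp at hk
    exact (hρsize k).exists
  · refine tendsto_nhds_unique ?_ hlim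
    simpa using (hNlim.comp hns.tendsto_atTop).mul_const (ψ (ξ.size + 1))

theorem integral_factorizedDuality_eq_pow (h0 : ∀ x, 0 ∈ Ehat x) (h1 : ∀ x, 1 ∈ Ehat x)
    (hcons : ConservesParticles Phat) (hdual : IsDual Phat P (factorizedDuality Ehat d))
    (hd : ∀ x, ∀ k ∈ Ehat x, Measurable (d x k)) (hBHT : BoundedHarmonicTriviality Phat)
    (hUD : UniformDomination (factorizedDuality Ehat d) μ) (hstat : P.IsStationary μ)
    (herg : P.IsTimeErgodic μ)
    (hp : ∀ x y, Tendsto (fun t : ℝ≥0 => (Phat.kernel t (FiniteConfig.delta h0 h1 x)).real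
      {FiniteConfig.delta h0 h1 y}) atTop (𝓝 0)) (ξ : FiniteConfig Ehat) (x : V) :
    ∫ η, factorizedDuality Ehat d ξ η ∂μ =
      (∫ η, factorizedDuality Ehat d (FiniteConfig.delta h0 h1 x) η ∂μ) ^ ξ.size := by
  obtain ⟨ψ, hψ⟩ := exists_integral_eq_size hcons hdual hBHT
    (measurable_factorizedDuality hd) hUD hstat
  have key : ∀ n, (∃ ξ : FiniteConfig Ehat, ξ.size = n) ∧ ψ n = ψ 1 ^ n := by
    intro n
    induction n with
    | zero =>
      refine ⟨⟨FiniteConfig.empty h0, FiniteConfig.size_empty h0⟩, ?_⟩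
      rw [← FiniteConfig.size_empty h0, ← hψ, FiniteConfig.size_empty]
      simp [factorizedDuality_empty]
    | succ n ih =>
      obtain ⟨⟨ξ, rfl⟩, hn⟩ := ih
      obtain ⟨hex, hmul⟩ := exists_size_succ_and_integral_mul h0 h1 hcons hdual hd hUD hstat herg
        x (hp x) hψ ξ
      exact ⟨hex, by rw [hmul, hn, pow_succ]⟩
  rw [hψ, hψ, FiniteConfig.size_delta, (key _).2]

end Factorization

/-! ### From probability measures to signed densities -/

section Determining

variable {Ω α : Type*} [MeasurableSpace Ω] [MeasurableSpace α] {μ : Measure Ω} {X : Ω → α}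

theorem isProbabilityMeasure_map_withDensity_ofReal {p : Ω → ℝ} (hX : Measurable X)
    (hp : Integrable p μ) (hp0 : ∀ ω, 0 ≤ p ω) (hp1 : ∫ ω, p ω ∂μ = 1) :
    IsProbabilityMeasure ((μ.withDensity fun ω => ENNReal.ofReal (p ω)).map X) := by
  refine ⟨?_⟩
  rw [Measure.map_apply hX MeasurableSet.univ, Set.preimage_univ,
    withDensity_apply _ MeasurableSet.univ, Measure.restrict_univ,
    ← ofReal_integral_eq_lintegral_ofReal hp (ae_of_all _ hp0), hp1, ENNReal.ofReal_one]

theorem integrable_map_withDensity_ofReal {p : Ω → ℝ} (hX : Measurable X) (hpm : Measurable p)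
    (hp0 : ∀ ω, 0 ≤ p ω) {f : α → ℝ} (hf : Measurable f)
    (hfi : Integrable (fun ω => p ω * f (X ω)) μ) :
    Integrable f ((μ.withDensity fun ω => ENNReal.ofReal (p ω)).map X) := by
  rw [integrable_map_measure hf.aestronglyMeasurable hX.aemeasurable,
    integrable_withDensity_iff_integrable_smul' hpm.ennreal_ofReal (by simp)]
  simpa only [ENNReal.toReal_ofReal (hp0 _), smul_eq_mul, Function.comp_apply] using hfi

theorem integral_map_withDensity_ofReal {p : Ω → ℝ} (hX : Measurable X) (hpm : Measurable p)
    (hp0 : ∀ ω, 0 ≤ p ω) {f : α → ℝ} (hf : Measurable f) :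
    ∫ a, f a ∂((μ.withDensity fun ω => ENNReal.ofReal (p ω)).map X) =
      ∫ ω, p ω * f (X ω) ∂μ := by
  rw [integral_map hX.aemeasurable hf.aestronglyMeasurable,
    integral_withDensity_eq_integral_toReal_smul hpm.ennreal_ofReal (by simp)]
  simp only [ENNReal.toReal_ofReal (hp0 _), smul_eq_mul]

/-- A family of functions that determines probability measures also determines the signed measures
with density: if `G` is orthogonal to all `f k ∘ X` and to constants, then it is orthogonal to every
event described by `X`. -/
theorem setIntegral_eq_zero_of_determining [IsProbabilityMeasure μ] (hX : Measurable X)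
    {K : Set ℕ} {f : ℕ → α → ℝ} (hf : ∀ k ∈ K, Measurable (f k))
    (hdet : ∀ ν ν' : Measure α, IsProbabilityMeasure ν → IsProbabilityMeasure ν' →
      (∀ k ∈ K, Integrable (f k) ν ∧ Integrable (f k) ν' ∧ ∫ e, f k e ∂ν = ∫ e, f k e ∂ν') → ν = ν')
    {G : Ω → ℝ} (hGm : Measurable G) (hG : Integrable G μ) (hG0 : ∫ ω, G ω ∂μ = 0)
    (hfi : ∀ k ∈ K, Integrable (fun ω => f k (X ω)) μ)
    (hGfi : ∀ k ∈ K, Integrable (fun ω => G ω * f k (X ω)) μ)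
    (hGf : ∀ k ∈ K, ∫ ω, G ω * f k (X ω) ∂μ = 0) {B : Set α} (hB : MeasurableSet B) :
    ∫ ω in X ⁻¹' B, G ω ∂μ = 0 := by
  set m : ℝ := ∫ ω, (|G ω| + 1) ∂μ with hm
  have hGa : Integrable (fun ω => |G ω| + 1) μ := hG.abs.add (integrable_const 1)
  have hmpos : 0 < m := by
    have : ∫ ω, (1 : ℝ) ∂μ ≤ m :=
      integral_mono (integrable_const 1) hGa fun ω => by simp
    simp only [integral_const, probReal_univ, smul_eq_mul, mul_one] at this
    linarith
  -- For `c = 0` and `c = 1` these are probability densities with difference `m⁻¹ * G` whose images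
  -- under `X` have equal integrals of all `f k`. The summand `1` keeps `m` positive even if `G`
  -- vanishes.
  set p : ℝ → Ω → ℝ := fun c ω => m⁻¹ * (|G ω| + 1 + c * G ω) with hp
  have hpm : ∀ c, Measurable (p c) := fun c => by fun_prop
  have hpi : ∀ c, Integrable (p c) μ := fun c => (hGa.add (hG.const_mul c)).const_mul _
  have hp0 : ∀ c, |c| ≤ 1 → ∀ ω, 0 ≤ p c ω := fun c hc ω => by
    have h1 : |c * G ω| ≤ |G ω| := by
      rw [abs_mul]
      exact mul_le_of_le_one_left (abs_nonneg _) hc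
    have h2 := neg_abs_le (c * G ω)
    exact mul_nonneg (inv_nonneg.2 hmpos.le) (by linarith)
  have hp1 : ∀ c, ∫ ω, p c ω ∂μ = 1 := fun c => by
    simp only [hp]
    rw [integral_const_mul, integral_add hGa (hG.const_mul c), integral_const_mul, hG0, mul_zero,
      add_zero]
    exact inv_mul_cancel₀ hmpos.ne'
  have habs : ∀ k ∈ K, Integrable (fun ω => (|G ω| + 1) * f k (X ω)) μ := fun k hk => by
    refine ((hGfi k hk).abs.add (hfi k hk).abs).mono'
      (((hGm.abs.add_const 1).mul ((hf k hk).comp hX)).aestronglyMeasurable)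
      (ae_of_all _ fun ω => ?_)
    rw [Real.norm_eq_abs, abs_mul, abs_of_nonneg (by positivity), Pi.add_apply, abs_mul, add_mul,
      one_mul]
  have hsplit : ∀ c k ω, p c ω * f k (X ω) =
      m⁻¹ * ((|G ω| + 1) * f k (X ω) + c * (G ω * f k (X ω))) := fun c k ω => by
    simp only [hp]; ring
  have hpfi : ∀ c, ∀ k ∈ K, Integrable (fun ω => p c ω * f k (X ω)) μ := fun c k hk => by
    simp only [hsplit]
    exact ((habs k hk).add ((hGfi k hk).const_mul c)).const_mul _
  have hpf : ∀ c, ∀ k ∈ K, ∫ ω, p c ω * f k (X ω) ∂μ = m⁻¹ * ∫ ω, (|G ω| + 1) * f k (X ω) ∂μ :=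
    fun c k hk => by
      simp only [hsplit]
      rw [integral_const_mul, integral_add (habs k hk) ((hGfi k hk).const_mul c),
        integral_const_mul, hGf k hk, mul_zero, add_zero]
  have h1 : |(1 : ℝ)| ≤ 1 := by simp
  have h0 : |(0 : ℝ)| ≤ 1 := by simp
  have heq := hdet _ _
    (isProbabilityMeasure_map_withDensity_ofReal hX (hpi 1) (hp0 1 h1) (hp1 1))
    (isProbabilityMeasure_map_withDensity_ofReal hX (hpi 0) (hp0 0 h0) (hp1 0)) fun k hk =>
    ⟨integrable_map_withDensity_ofReal hX (hpm 1) (hp0 1 h1) (hf k hk) (hpfi 1 k hk),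
      integrable_map_withDensity_ofReal hX (hpm 0) (hp0 0 h0) (hf k hk) (hpfi 0 k hk), by
      rw [integral_map_withDensity_ofReal hX (hpm 1) (hp0 1 h1) (hf k hk),
        integral_map_withDensity_ofReal hX (hpm 0) (hp0 0 h0) (hf k hk), hpf 1 k hk, hpf 0 k hk]⟩
  have hB' := hX hB
  have hset : ∫ ω in X ⁻¹' B, p 1 ω ∂μ = ∫ ω in X ⁻¹' B, p 0 ω ∂μ := by
    have h2 := congrArg (fun ν : Measure α => ν B) heq
    simp only [Measure.map_apply hX hB, withDensity_apply _ hB'] at h2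
    rw [← ofReal_integral_eq_lintegral_ofReal (hpi 1).integrableOn (ae_of_all _ (hp0 1 h1)),
      ← ofReal_integral_eq_lintegral_ofReal (hpi 0).integrableOn (ae_of_all _ (hp0 0 h0))] at h2
    exact (ENNReal.ofReal_eq_ofReal_iff (integral_nonneg (hp0 1 h1))
      (integral_nonneg (hp0 0 h0))).1 h2
  have h3 : ∫ ω in X ⁻¹' B, (p 1 ω - p 0 ω) ∂μ = m⁻¹ * ∫ ω in X ⁻¹' B, G ω ∂μ := by
    rw [← integral_const_mul]
    congr 1 with ω
    simp only [hp]; ring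
  rw [integral_sub (hpi 1).integrableOn (hpi 0).integrableOn, hset, sub_self] at h3
  exact (mul_eq_zero.1 h3.symm).resolve_left (inv_ne_zero hmpos.ne')

end Determining

/-! ### Product structure of the measure -/

section Product

variable {V : Type*} {E : V → Type*} [∀ x, MeasurableSpace (E x)] {Ehat : V → Set ℕ}
  {d : (x : V) → ℕ → E x → ℝ} {μ : Measure ((x : V) → E x)}

/-- The configuration with `k` particles at `x` and no others. -/
noncomputable def FiniteConfig.single (h0 : ∀ x, 0 ∈ Ehat x) (x : V) {k : ℕ} (hk : k ∈ Ehat x) :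
    FiniteConfig Ehat :=
  ⟨Finsupp.single x k, fun y => by
    classical
    rw [Finsupp.single_apply]
    split_ifs with h
    · exact h ▸ hk
    · exact h0 y⟩

/-- Keeping a spare factor `D(ξ, ·)` off `S` makes the induction work: when a site `x` is added, the
hypothesis for `ξ` with `k` extra particles at `x` shows that the centred `G₀` is orthogonal to `d x
k`. -/
theorem integral_prod_indicator_mul_factorizedDuality [IsProbabilityMeasure μ]
    (h0 : ∀ x, 0 ∈ Ehat x) (hd : ∀ x, ∀ k ∈ Ehat x, Measurable (d x k))
    (hd_zero : ∀ x e, d x 0 e = 1) (hint : ∀ ξ, Integrable (factorizedDuality Ehat d ξ) μ) {c : ℝ}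
    (hpow : ∀ ξ : FiniteConfig Ehat, ∫ η, factorizedDuality Ehat d ξ η ∂μ = c ^ ξ.size)
    (hdet : MeasureDetermining Ehat d) {A : (x : V) → Set (E x)} (hA : ∀ x, MeasurableSet (A x))
    (S : Finset V) : ∀ ξ : FiniteConfig Ehat, Disjoint S ξ.1.support →
      ∫ η, (∏ x ∈ S, (A x).indicator 1 (η x)) * factorizedDuality Ehat d ξ η ∂μ =
        (∏ x ∈ S, μ.real ((fun η => η x) ⁻¹' A x)) * c ^ ξ.size := by
  classical
  have hD := measurable_factorizedDuality hd
  have hDsingle : ∀ x k (hk : k ∈ Ehat x) η,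
      factorizedDuality Ehat d (FiniteConfig.single h0 x hk) η = d x k (η x) := fun x k hk η =>
    Finsupp.prod_single_index (hd_zero _ _)
  have hsize : ∀ x k (hk : k ∈ Ehat x), (FiniteConfig.single h0 x hk).size = k := fun x k hk =>
    Finsupp.sum_single_index rfl
  have hAm : ∀ x, Measurable fun η : (x : V) → E x => (A x).indicator (1 : E x → ℝ) (η x) :=
    fun x => (measurable_one.indicator (hA x)).comp (measurable_pi_apply x)
  have hAle : ∀ x (e : E x), |(A x).indicator (1 : E x → ℝ) e| ≤ 1 := fun x e => by
    by_cases h : e ∈ A x <;> simp [h]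
  have hIm : ∀ S : Finset V, Measurable fun η : (x : V) → E x =>
      ∏ x ∈ S, (A x).indicator (1 : E x → ℝ) (η x) := fun S =>
    Finset.measurable_prod _ fun x _ => hAm x
  have hi : ∀ (S : Finset V) ξ, Integrable (fun η => (∏ x ∈ S, (A x).indicator 1 (η x)) *
      factorizedDuality Ehat d ξ η) μ := fun S ξ =>
    (hint ξ).bdd_mul (c := 1) (hIm S).aestronglyMeasurable (ae_of_all _ fun η => by
      rw [Real.norm_eq_abs, Finset.abs_prod]
      exact Finset.prod_le_one (fun _ _ => abs_nonneg _) fun x _ => hAle x _)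
  induction S using Finset.induction_on with
  | empty => intro ξ _; simp [hpow]
  | insert x S hx ih =>
    intro ξ hξ
    rw [Finset.disjoint_insert_left] at hξ
    obtain ⟨hxξ, hSξ⟩ := hξ
    set G₀ : ((x : V) → E x) → ℝ := fun η =>
      (∏ x ∈ S, (A x).indicator 1 (η x)) * factorizedDuality Ehat d ξ η with hG₀
    set q : ℝ := ∏ x ∈ S, μ.real ((fun η => η x) ⁻¹' A x) with hq
    have hG₀int : ∫ η, G₀ η ∂μ = q * c ^ ξ.size := ih ξ hSξ
    have hsupp : ∀ k (hk : k ∈ Ehat x), (FiniteConfig.single h0 x hk).1.support ⊆ {x} :=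
      fun k hk => Finsupp.support_single_subset
    have hdisj : ∀ k (hk : k ∈ Ehat x),
        Disjoint ξ.1.support (FiniteConfig.single h0 x hk).1.support := fun k hk =>
      (Finset.disjoint_singleton_right.2 hxξ).mono_right (hsupp k hk)
    have hdi : ∀ k ∈ Ehat x, Integrable (fun η => d x k (η x)) μ := fun k hk =>
      (hint (FiniteConfig.single h0 x hk)).congr (ae_of_all _ (hDsingle x k hk))
    have hmul : ∀ k (hk : k ∈ Ehat x) η, G₀ η * d x k (η x) =
        (∏ x ∈ S, (A x).indicator 1 (η x)) *
          factorizedDuality Ehat d (ξ.merge (FiniteConfig.single h0 x hk)) η := fun k hk η => by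
      rw [FiniteConfig.factorizedDuality_merge (hdisj k hk), hDsingle, mul_assoc]
    have hGdi : ∀ k ∈ Ehat x, Integrable (fun η => G₀ η * d x k (η x)) μ := fun k hk =>
      (hi S _).congr (ae_of_all _ fun η => (hmul k hk η).symm)
    have hGd : ∀ k ∈ Ehat x, ∫ η, G₀ η * d x k (η x) ∂μ = q * c ^ ξ.size * c ^ k := fun k hk => by
      simp_rw [hmul k hk]
      rw [ih, FiniteConfig.size_merge (hdisj k hk), hsize, pow_add, mul_assoc]
      rw [FiniteConfig.merge_val (hdisj k hk)]
      refine Disjoint.mono_right Finsupp.support_add (Finset.disjoint_union_right.2 ⟨hSξ, ?_⟩)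
      exact (Finset.disjoint_singleton_right.2 hx).mono_right (hsupp k hk)
    have hzero := setIntegral_eq_zero_of_determining (μ := μ) (X := fun η => η x)
      (measurable_pi_apply x) (hd x) (hdet x) (G := fun η => G₀ η - q * c ^ ξ.size)
      (((hIm S).mul (hD ξ)).sub_const _) ((hi S ξ).sub (integrable_const _))
      (by rw [integral_sub (hi S ξ) (integrable_const _), hG₀int]; simp) hdi
      (fun k hk => by
        simp only [sub_mul]
        exact (hGdi k hk).sub ((hdi k hk).const_mul _))
      (fun k hk => by
        simp only [sub_mul]
        rw [integral_sub (hGdi k hk) ((hdi k hk).const_mul _), hGd k hk, integral_const_mul,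
          ← integral_congr_ae (ae_of_all _ (hDsingle x k hk)), hpow, hsize, sub_self])
      (hA x)
    have hAx : MeasurableSet ((fun η : (x : V) → E x => η x) ⁻¹' A x) := measurable_pi_apply x (hA x)
    rw [integral_sub (hi S ξ).integrableOn (integrable_const _), setIntegral_const,
      smul_eq_mul, sub_eq_zero, ← integral_indicator hAx] at hzero
    rw [Finset.prod_insert hx, mul_assoc, ← hq, ← hzero]
    refine integral_congr_ae (ae_of_all _ fun η => ?_)
    simp only [Finset.prod_insert hx, mul_assoc]
    by_cases h : η x ∈ A x
    · rw [Set.indicator_of_mem h, Set.indicator_of_mem (by exact h), Pi.one_apply, one_mul]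
    · rw [Set.indicator_of_notMem h, Set.indicator_of_notMem (by exact h), zero_mul]

theorem isProductMeasure_of_integral_eq_pow [IsProbabilityMeasure μ]
    (h0 : ∀ x, 0 ∈ Ehat x) (hd : ∀ x, ∀ k ∈ Ehat x, Measurable (d x k))
    (hd_zero : ∀ x e, d x 0 e = 1) (hint : ∀ ξ, Integrable (factorizedDuality Ehat d ξ) μ) {c : ℝ}
    (hpow : ∀ ξ : FiniteConfig Ehat, ∫ η, factorizedDuality Ehat d ξ η ∂μ = c ^ ξ.size)
    (hdet : MeasureDetermining Ehat d) : IsProductMeasure μ := by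
  have hprob : ∀ x, IsProbabilityMeasure (μ.map fun η => η x) := fun x =>
    Measure.isProbabilityMeasure_map (measurable_pi_apply x).aemeasurable
  refine ⟨fun x => μ.map fun η => η x, hprob, Measure.eq_infinitePi _ fun S A hA => ?_⟩
  have hSm : MeasurableSet ((S : Set V).pi A) := MeasurableSet.pi S.countable_toSet fun x _ => hA x
  have h1 := integral_prod_indicator_mul_factorizedDuality h0 hd hd_zero hint hpow hdet hA S
    (FiniteConfig.empty h0) (by simp [FiniteConfig.empty])
  have h2 : ∀ η : (x : V) → E x, (∏ x ∈ S, (A x).indicator (1 : E x → ℝ) (η x)) *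
      factorizedDuality Ehat d (FiniteConfig.empty h0) η = ((S : Set V).pi A).indicator 1 η := fun η => by
    rw [factorizedDuality_empty, mul_one]
    by_cases h : η ∈ (S : Set V).pi A
    · rw [Set.indicator_of_mem h]
      exact Finset.prod_eq_one fun x hx => Set.indicator_of_mem (h x hx) _
    · rw [Set.indicator_of_notMem h]
      simp only [Set.mem_pi, not_forall] at h
      obtain ⟨x, hx, hxA⟩ := h
      exact Finset.prod_eq_zero hx (Set.indicator_of_notMem hxA _)
  simp_rw [h2] at h1
  rw [integral_indicator_one hSm, FiniteConfig.size_empty, pow_zero, mul_one] at h1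
  rw [← ENNReal.toReal_eq_toReal_iff' (measure_ne_top _ _)
    (ENNReal.prod_ne_top fun x _ => measure_ne_top _ _), ENNReal.toReal_prod]
  simp_rw [Measure.map_apply (measurable_pi_apply _) (hA _)]
  exact h1

end Product

theorem theorem3p4 {dim : ℕ}
    -- the single-site state spaces of the process and of its discrete dual
    (E : (Fin dim → ℤ) → Type*) [∀ x, MeasurableSpace (E x)]
    (Ehat : (Fin dim → ℤ) → Set ℕ) (h0 : ∀ x, 0 ∈ Ehat x) (h1 : ∀ x, 1 ∈ Ehat x)
    -- the process and its dual, a conservative particle system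
    (P : MarkovProcess ((x : Fin dim → ℤ) → E x))
    (Phat : MarkovProcess (FiniteConfig Ehat)) (hcons : ConservesParticles Phat)
    -- factorized duality
    (d : (x : Fin dim → ℤ) → ℕ → E x → ℝ)
    (hd_meas : ∀ x, ∀ k ∈ Ehat x, Measurable (d x k))
    (hd_zero : ∀ x e, d x 0 e = 1)
    (hdual : IsDual Phat P (factorizedDuality Ehat d))
    -- bounded harmonic triviality and uniform domination
    (hBHT : BoundedHarmonicTriviality Phat)
    (μ : Measure ((x : Fin dim → ℤ) → E x)) [IsProbabilityMeasure μ]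
    (hUD : UniformDomination (factorizedDuality Ehat d) μ)
    -- the measure is stationary and ergodic in time
    (hstat : P.IsStationary μ) (herg : P.IsTimeErgodic μ)
    -- the transition probabilities of a single dual particle vanish as time goes to infinity
    (hp : ∀ x y, Tendsto (fun t : ℝ≥0 => (Phat.kernel t (FiniteConfig.delta h0 h1 x)).real
      {FiniteConfig.delta h0 h1 y}) atTop (𝓝 0)) :
    (∀ (ξ : FiniteConfig Ehat) (x : Fin dim → ℤ),
      ∫ η, factorizedDuality Ehat d ξ η ∂μ =
        (∫ η, factorizedDuality Ehat d (FiniteConfig.delta h0 h1 x) η ∂μ) ^ ξ.size) ∧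
    (MeasureDetermining Ehat d → IsProductMeasure μ) := by
  refine ⟨integral_factorizedDuality_eq_pow h0 h1 hcons hdual hd_meas hBHT hUD hstat herg hp,
    fun hdet => ?_⟩
  exact isProductMeasure_of_integral_eq_pow h0 hd_meas hd_zero
    (hUD.integrable (measurable_factorizedDuality hd_meas))
    -- The origin serves as reference site; any other site gives the same constant `c`.
    (fun ξ => integral_factorizedDuality_eq_pow h0 h1 hcons hdual hd_meas hBHT hUD hstat herg hp
      ξ 0) hdet
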